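/- Let $n\ge 2$, let $T^n=\mathbb R^n/\mathbb Z^n$, and let $\mathrm{Diff}(T^n)$ be the group of $C^\infty$ diffeomorphisms of $T^n$. Let $a_1,\dots,a_n\in\mathbb R$ be linearly independent over $\mathbb Q$, let $X=\sum_{i=1}^n a_i\,\partial/\partial\theta_i$ be the corresponding constant vector field on $T^n$, and let $\phi_t(\theta)=\theta+t(a_1,\dots,a_n) \bmod \mathbb Z^n$ be its flow. Let $S_\phi$ be the normalizer in $\mathrm{Diff}(T^n)$ of the subgroup $F_\phi=\{\phi_t:t\in\mathbb R\}$. For every $R\in S_\phi$ there is a unique nonzero real number $\rho_\phi(R)$ such that $R\phi_t=\phi_{\rho_\phi(R)t}R$ for all $t\in\mathbb R$, and $\rho_\phi:S_\phi\to\mathbb R^*$ is a group homomorphism. Let $\Lambda$ be any subgroup of $\rho_\phi(S_\phi)$ with $\Lambda\neq\{1\}$. Then: 1. The group $\rho_\phi^{-1}(\Lambda)$ is the internal semidirect product of the normal subgroup $\ker\rho_\phi$ by a subgroup isomorphic to $\Lambda$, and $\ker\rho_\phi$ is isomorphic to the abelian group $T^n$. 2. This semidirect product is not direct: no complement of $\ker\rho_\phi$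 in $\rho_\phi^{-1}(\Lambda)$ is a normal subgroup. 3. Every element of $\Lambda$ is a real algebraic integer of degree at most $n$, that is, a root of a monic polynomial in $\mathbb Z[z]$ of degree at most $n$. 4. $\Lambda$ is isomorphic to an abelian subgroup of $\mathrm{GL}(n,\mathbb Z)$. -/

import Mathlib

open scoped Manifold ContDiff Topology

noncomputable section

/-- The `n`-torus `T^n = ℝ^n / ℤ^n`, as a topological abelian group. -/
abbrev Torus (n : ℕ) : Type := Fin n → UnitAddCircle

namespace Torus

variable {n : ℕ}

/-- The covering projection `π : ℝ^n → T^n`. -/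
def proj (x : Fin n → ℝ) : Torus n := fun i => (x i : UnitAddCircle)

/-! ### The smooth structure for which `π` is a local diffeomorphism -/

/-- The restriction of `π` to the open unit cube centred at `x`, a homeomorphism onto its image. -/
def box (x : Fin n → ℝ) : OpenPartialHomeomorph (Fin n → ℝ) (Torus n) :=
  OpenPartialHomeomorph.pi fun i => AddCircle.openPartialHomeomorphCoe (1 : ℝ) (x i - 1 / 2)

theorem box_apply (x y : Fin n → ℝ) : box x y = proj y := rfl

theorem mem_box_source (x : Fin n → ℝ) : x ∈ (box x).source := by
  intro i _
  simp only [AddCircle.openPartialHomeomorphCoe_source, Set.mem_Ioo]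
  constructor <;> linarith

theorem proj_surjective : Function.Surjective (proj : (Fin n → ℝ) → Torus n) := fun θ =>
  ⟨fun i => (QuotientAddGroup.mk_surjective (θ i)).choose,
    funext fun i => (QuotientAddGroup.mk_surjective (θ i)).choose_spec⟩

/-- A representative in `ℝ^n` of a point of the torus. -/
def rep (θ : Torus n) : Fin n → ℝ := (proj_surjective θ).choose

theorem proj_rep (θ : Torus n) : proj (rep θ) = θ := (proj_surjective θ).choose_spec

/-- The charts of `T^n` are the local inverses of `π` with values in open unit cubes. -/
instance : ChartedSpace (Fin n → ℝ) (Torus n) where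
  atlas := Set.range fun x => (box x).symm
  chartAt θ := (box (rep θ)).symm
  mem_chart_source θ := by
    have h := (box (rep θ)).map_source (mem_box_source (rep θ))
    rwa [box_apply, proj_rep] at h
  chart_mem_atlas θ := ⟨rep θ, rfl⟩

theorem proj_add (x y : Fin n → ℝ) : proj (x + y) = proj x + proj y := rfl

theorem proj_sub (x y : Fin n → ℝ) : proj (x - y) = proj x - proj y := rfl

theorem continuous_proj : Continuous (proj : (Fin n → ℝ) → Torus n) :=
  continuous_pi fun i => (AddCircle.continuous_mk' (1 : ℝ)).comp (continuous_apply i)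

/-- A local inverse of `π` composed with `π` is locally a translation. -/
theorem box_symm_proj_eventuallyEq (x y : Fin n → ℝ) (h : proj y ∈ (box x).target) :
    ∀ᶠ z in 𝓝 y, (box x).symm (proj z) = z + ((box x).symm (proj y) - y) := by
  have hy : (box x).symm (proj y) ∈ (box x).source := (box x).map_target h
  have hc : ContinuousAt (fun z : Fin n → ℝ => z + ((box x).symm (proj y) - y)) y := by
    fun_prop
  have hmem : ∀ᶠ z in 𝓝 y, z + ((box x).symm (proj y) - y) ∈ (box x).source := by
    refine hc.eventually_mem ((box x).open_source.mem_nhds ?_)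
    simpa using hy
  filter_upwards [hmem] with z hz
  have h1 : proj (z + ((box x).symm (proj y) - y)) = proj z := by
    rw [proj_add, proj_sub, ← box_apply x ((box x).symm (proj y)), (box x).right_inv h]
    simp
  rw [← h1, ← box_apply x, (box x).left_inv hz]

instance : IsManifold 𝓘(ℝ, Fin n → ℝ) ∞ (Torus n) := by
  refine isManifold_of_contDiffOn _ _ _ ?_
  rintro _ _ ⟨x, rfl⟩ ⟨x', rfl⟩ y hy
  simp only [modelWithCornersSelf_coe, modelWithCornersSelf_coe_symm, Function.comp_def,
    Set.range_id, Set.inter_univ, OpenPartialHomeomorph.symm_symm] at hy ⊢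
  have hy' : proj y ∈ (box x').target := hy.2
  refine ContDiffAt.contDiffWithinAt ?_
  refine ContDiffAt.congr_of_eventuallyEq (f := fun z => z + ((box x').symm (proj y) - y)) ?_ ?_
  · fun_prop
  · exact box_symm_proj_eventuallyEq x' y hy'

theorem contMDiff_proj :
    ContMDiff 𝓘(ℝ, Fin n → ℝ) 𝓘(ℝ, Fin n → ℝ) ∞ (proj : (Fin n → ℝ) → Torus n) := by
  intro y
  have h : (box y).symm ∈ IsManifold.maximalAtlas 𝓘(ℝ, Fin n → ℝ) ∞ (Torus n) :=
    IsManifold.subset_maximalAtlas ⟨y, rfl⟩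
  exact (contMDiffOn_symm_of_mem_maximalAtlas h).contMDiffAt
    ((box y).open_source.mem_nhds (mem_box_source y))

/-- A self-map of the torus with a smooth lift is smooth. -/
theorem contMDiff_of_lift {f : Torus n → Torus n} {F : (Fin n → ℝ) → (Fin n → ℝ)}
    (hF : ContDiff ℝ ∞ F) (h : ∀ x, f (proj x) = proj (F x)) :
    ContMDiff 𝓘(ℝ, Fin n → ℝ) 𝓘(ℝ, Fin n → ℝ) ∞ f := by
  intro θ
  have hθ : θ ∈ (box (rep θ)).symm.source := mem_chart_source (Fin n → ℝ) θ
  have hm : (box (rep θ)).symm ∈ IsManifold.maximalAtlas 𝓘(ℝ, Fin n → ℝ) ∞ (Torus n) :=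
    IsManifold.subset_maximalAtlas ⟨rep θ, rfl⟩
  have h1 : ContMDiffAt 𝓘(ℝ, Fin n → ℝ) 𝓘(ℝ, Fin n → ℝ) ∞
      (fun η => proj (F ((box (rep θ)).symm η))) θ :=
    (contMDiff_proj _).comp θ ((hF.contMDiff _).comp θ (contMDiffAt_of_mem_maximalAtlas hm hθ))
  refine h1.congr_of_eventuallyEq ?_
  filter_upwards [(box (rep θ)).symm.open_source.mem_nhds hθ] with η hη
  rw [← h, ← box_apply (rep θ), (box (rep θ)).right_inv hη]

end Torus

/-! ### The group `Diff(T^n)` -/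

/-- The `C^∞` diffeomorphisms of the torus. -/
abbrev TorusDiffeo (n : ℕ) : Type :=
  Diffeomorph 𝓘(ℝ, Fin n → ℝ) 𝓘(ℝ, Fin n → ℝ) (Torus n) (Torus n) ∞

namespace TorusDiffeo

variable {n : ℕ}

/-- `Diff(T^n)` is a group under composition, `(f * g) θ = f (g θ)`. -/
instance : Group (TorusDiffeo n) where
  mul f g := g.trans f
  one := Diffeomorph.refl _ _ _
  inv f := f.symm
  mul_assoc _ _ _ := rfl
  one_mul _ := rfl
  mul_one _ := rfl
  inv_mul_cancel f := Diffeomorph.ext fun θ => f.symm_apply_apply θ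

theorem mul_apply (f g : TorusDiffeo n) (θ : Torus n) : (f * g) θ = f (g θ) := rfl

theorem one_apply (θ : Torus n) : (1 : TorusDiffeo n) θ = θ := rfl

/-- The translation of the torus by `c`. -/
def translation (c : Torus n) : TorusDiffeo n where
  toEquiv := Equiv.addRight c
  contMDiff_toFun := Torus.contMDiff_of_lift (F := fun x => x + Torus.rep c) (by fun_prop)
    fun x => by simp [Torus.proj_add, Torus.proj_rep]
  contMDiff_invFun := Torus.contMDiff_of_lift (F := fun x => x - Torus.rep c) (by fun_prop)
    fun x => by rw [Torus.proj_sub, Torus.proj_rep, sub_eq_add_neg]; rfl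

theorem translation_apply (c θ : Torus n) : translation c θ = θ + c := rfl

end TorusDiffeo

/-! ### The flow of a constant vector field -/

variable {n : ℕ}

/-- The constant vector field `X = ∑ i, a i ∂/∂θ i` on `T^n`. Since all charts of `T^n` are local
inverses of `π`, which differ by translations, its components in the chart at every point
are `a`. -/
def constantField (a : Fin n → ℝ) (θ : Torus n) : TangentSpace 𝓘(ℝ, Fin n → ℝ) θ := a

/-- The flow `φ_t (θ) = θ + π (t a)` generated by `constantField a`. -/
def constantFlow (a : Fin n → ℝ) (t : ℝ) : TorusDiffeo n :=
  TorusDiffeo.translation (Torus.proj (t • a))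

theorem constantFlow_apply (a : Fin n → ℝ) (t : ℝ) (θ : Torus n) :
    constantFlow a t θ = θ + Torus.proj (t • a) := rfl

theorem constantFlow_zero (a : Fin n → ℝ) : constantFlow a 0 = 1 := by
  refine Diffeomorph.ext fun θ => ?_
  rw [constantFlow_apply, TorusDiffeo.one_apply]
  ext i
  simp [Torus.proj]

theorem constantFlow_add (a : Fin n → ℝ) (s t : ℝ) :
    constantFlow a (s + t) = constantFlow a s * constantFlow a t := by
  refine Diffeomorph.ext fun θ => ?_
  rw [TorusDiffeo.mul_apply]
  simp only [constantFlow_apply, add_smul, Torus.proj_add]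
  abel

/-- The orbits of `constantFlow a` are the integral curves of `constantField a`. -/
theorem isMIntegralCurve_constantFlow (a : Fin n → ℝ) (θ : Torus n) :
    IsMIntegralCurve (I := 𝓘(ℝ, Fin n → ℝ)) (fun t => constantFlow a t θ) (constantField a) := by
  have hcurve : ∀ s, constantFlow a s θ = Torus.proj (Torus.rep θ + s • a) := fun s => by
    rw [constantFlow_apply, Torus.proj_add, Torus.proj_rep]
  have hc : Continuous fun s : ℝ => Torus.rep θ + s • a := by fun_prop
  simp only [hcurve]
  intro t
  refine ⟨(Torus.continuous_proj.comp hc).continuousAt, ?_⟩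
  have hmem : Torus.proj (Torus.rep θ + t • a) ∈
      (Torus.box (Torus.rep (Torus.proj (Torus.rep θ + t • a)))).target :=
    mem_chart_source (Fin n → ℝ) (Torus.proj (Torus.rep θ + t • a))
  have hev := hc.continuousAt.eventually
    (Torus.box_symm_proj_eventuallyEq _ (Torus.rep θ + t • a) hmem)
  have hd : HasFDerivAt (fun s : ℝ => Torus.rep θ + s • a +
      ((Torus.box (Torus.rep (Torus.proj (Torus.rep θ + t • a)))).symm
        (Torus.proj (Torus.rep θ + t • a)) - (Torus.rep θ + t • a)))
      ((1 : ℝ →L[ℝ] ℝ).smulRight a) t :=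
    (((1 : ℝ →L[ℝ] ℝ).smulRight a).hasFDerivAt.const_add _).add_const _
  exact (hd.congr_of_eventuallyEq hev).hasFDerivWithinAt

/-- `F_φ = {φ_t : t ∈ ℝ}`, as a subgroup of `Diff(T^n)`. -/
def flowSubgroup (a : Fin n → ℝ) : Subgroup (TorusDiffeo n) where
  carrier := Set.range (constantFlow a)
  one_mem' := ⟨0, constantFlow_zero a⟩
  mul_mem' := by
    rintro _ _ ⟨s, rfl⟩ ⟨t, rfl⟩
    exact ⟨s + t, constantFlow_add a s t⟩
  inv_mem' := by
    rintro _ ⟨t, rfl⟩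
    refine ⟨-t, eq_inv_of_mul_eq_one_left ?_⟩
    rw [← constantFlow_add, neg_add_cancel, constantFlow_zero]

/-- The generalized symmetry group `S_φ`: the normalizer of `F_φ` in `Diff(T^n)`. -/
def generalizedSymmetryGroup (a : Fin n → ℝ) : Subgroup (TorusDiffeo n) :=
  Subgroup.normalizer (flowSubgroup a : Set (TorusDiffeo n))

/-! ### The multiplier representation -/

theorem proj_eq_zero_iff (x : Fin n → ℝ) : Torus.proj x = 0 ↔ ∃ m : Fin n → ℤ, ∀ i, x i = m i := by
  rw [← Classical.skolem (p := fun i (m : ℤ) => x i = m), funext_iff]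
  refine forall_congr' fun i => ?_
  change ((x i : ℝ) : AddCircle (1 : ℝ)) = 0 ↔ _
  rw [AddCircle.coe_eq_zero_iff]
  simp [eq_comm]

/-- Two rationally independent numbers satisfy no nontrivial integral linear relation. -/
theorem int_relation_eq_zero (hn : 2 ≤ n) {a : Fin n → ℝ} (ha : LinearIndependent ℚ a)
    (k l : ℤ) (h : a ⟨0, by omega⟩ * k = a ⟨1, by omega⟩ * l) : k = 0 ∧ l = 0 := by
  have hp : LinearIndependent ℚ ![a ⟨0, by omega⟩, a ⟨1, by omega⟩] := by
    have h2 := ha.comp ![(⟨0, by omega⟩ : Fin n), ⟨1, by omega⟩] (by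
      intro i j hij
      fin_cases i <;> fin_cases j <;> simp_all)
    convert h2 using 1
    funext i
    fin_cases i <;> rfl
  have := LinearIndependent.pair_iff.mp hp (k : ℚ) (-l : ℚ) (by
    simp only [Rat.smul_def]
    push_cast
    linarith)
  simpa using this

theorem constantFlow_injective (hn : 2 ≤ n) {a : Fin n → ℝ} (ha : LinearIndependent ℚ a) :
    Function.Injective (constantFlow a) := by
  intro s t hst
  have h0 := congrArg (fun f : TorusDiffeo n => f 0) hst
  simp only [constantFlow_apply, zero_add] at h0
  have h1 : Torus.proj ((s - t) • a) = 0 := by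
    rw [sub_smul, Torus.proj_sub, h0, sub_self]
  obtain ⟨m, hm⟩ := (proj_eq_zero_iff _).mp h1
  have e0 := hm ⟨0, by omega⟩
  have e1 := hm ⟨1, by omega⟩
  simp only [Pi.smul_apply, smul_eq_mul] at e0 e1
  have hk := int_relation_eq_zero hn ha (m ⟨1, by omega⟩) (m ⟨0, by omega⟩) (by
    rw [← e0, ← e1]; ring)
  rw [hk.2, Int.cast_zero] at e0
  rcases mul_eq_zero.mp e0 with h | h
  · linarith
  · exact absurd h (ha.ne_zero _)

/-- Every continuous one-parameter subgroup of the circle is `t ↦ b t mod 1`. -/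
theorem exists_slope {c : ℝ → UnitAddCircle} (hc : Continuous c)
    (hadd : ∀ s t, c (s + t) = c s + c t) : ∃ b : ℝ, ∀ t, c t = ((b * t : ℝ) : UnitAddCircle) := by
  have hc0 : c 0 = 0 := by simpa using hadd 0 0
  obtain ⟨g, ⟨hg0, hg⟩, -⟩ := (AddCircle.isCoveringMap_coe (1 : ℝ)).existsUnique_continuousMap_lifts
    (⟨c, hc⟩ : C(ℝ, UnitAddCircle)) 0 0 (by simp [hc0])
  have hgc : ∀ t, ((g t : ℝ) : UnitAddCircle) = c t := fun t => congrFun hg t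
  have hgadd : ∀ s t, g (s + t) = g s + g t := by
    intro s t
    have hd : Continuous fun p : ℝ × ℝ => g (p.1 + p.2) - g p.1 - g p.2 := by fun_prop
    have hint : ∀ p : ℝ × ℝ, ∃ m : ℤ, (m : ℝ) = g (p.1 + p.2) - g p.1 - g p.2 := by
      intro p
      have : ((g (p.1 + p.2) - g p.1 - g p.2 : ℝ) : AddCircle (1 : ℝ)) = 0 := by
        rw [AddCircle.coe_sub, AddCircle.coe_sub]
        change ((_ : ℝ) : UnitAddCircle) - ((_ : ℝ) : UnitAddCircle) - ((_ : ℝ) : UnitAddCircle) = 0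
        rw [hgc, hgc, hgc, hadd]
        abel
      obtain ⟨m, hm⟩ := (AddCircle.coe_eq_zero_iff (1 : ℝ)).mp this
      exact ⟨m, by simpa using hm⟩
    choose m hm using hint
    have hmc : Continuous m := by
      rw [Int.isClosedEmbedding_coe_real.isEmbedding.continuous_iff]
      exact hd.congr fun p => (hm p).symm
    have hmz : m (s, t) = m (0, 0) := PreconnectedSpace.constant inferInstance hmc
    have h1 := hm (s, t)
    have h2 := hm (0, 0)
    rw [hmz, h2] at h1
    simp only [add_zero, hg0] at h1
    linarith
  let G : ℝ →+ ℝ := AddMonoidHom.mk' g hgadd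
  let L := G.toRealLinearMap g.continuous
  refine ⟨g 1, fun t => ?_⟩
  have : g t = g 1 * t := by
    have h := L.map_smul t 1
    simp only [smul_eq_mul, mul_one] at h
    change g t = t * g 1 at h
    rw [h, mul_comm]
  rw [← this, hgc]

/-- Every generalized symmetry `R` has a unique multiplier: a real number `α ≠ 0` such that
`R φ_t = φ_{α t} R` for all `t`. -/
theorem existsUnique_multiplier (hn : 2 ≤ n) {a : Fin n → ℝ} (ha : LinearIndependent ℚ a)
    (R : generalizedSymmetryGroup a) :
    ∃! α : ℝˣ, ∀ t : ℝ,
      (R : TorusDiffeo n) * constantFlow a t = constantFlow a (α * t) * (R : TorusDiffeo n) := by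
  obtain ⟨R, hR⟩ := R
  have hinj := constantFlow_injective hn ha
  have hs : ∀ t, ∃ s, R * constantFlow a t = constantFlow a s * R := by
    intro t
    have h := (Subgroup.mem_normalizer_iff.mp hR (constantFlow a t)).mp ⟨t, rfl⟩
    obtain ⟨s, hs⟩ := h
    exact ⟨s, by rw [hs, inv_mul_cancel_right]⟩
  choose s hs using hs
  have hcomp : ∀ t, R (Torus.proj (t • a)) - R 0 = Torus.proj (s t • a) := by
    intro t
    have h := congrArg (fun f : TorusDiffeo n => f 0) (hs t)
    simp only [TorusDiffeo.mul_apply, constantFlow_apply, zero_add] at h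
    rw [h, add_sub_cancel_left]
  have hsadd : ∀ t u, s (t + u) = s t + s u := by
    intro t u
    apply hinj
    apply mul_right_cancel (b := R)
    rw [← hs, constantFlow_add, ← mul_assoc, hs, mul_assoc, hs, ← mul_assoc, ← constantFlow_add]
  have hcont : Continuous fun t : ℝ => Torus.proj (s t • a) := by
    have h1 : Continuous fun t : ℝ => R (Torus.proj (t • a)) - R 0 :=
      (R.continuous.comp (Torus.continuous_proj.comp (by fun_prop))).sub continuous_const
    exact h1.congr hcomp
  have hb : ∀ i : Fin n, ∃ b : ℝ, ∀ t, ((s t * a i : ℝ) : UnitAddCircle) = ((b * t : ℝ) : _) := by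
    intro i
    refine exists_slope (c := fun t => ((s t * a i : ℝ) : UnitAddCircle)) ?_ ?_
    · exact (continuous_apply i).comp hcont
    · intro t u
      rw [hsadd, add_mul]
      rfl
  choose b hb using hb
  have hm : ∀ i t, ∃ m : ℤ, (m : ℝ) = s t * a i - b i * t := by
    intro i t
    have : ((s t * a i - b i * t : ℝ) : AddCircle (1 : ℝ)) = 0 := by
      rw [AddCircle.coe_sub]
      exact sub_eq_zero.mpr (hb i t)
    obtain ⟨m, hm⟩ := (AddCircle.coe_eq_zero_iff (1 : ℝ)).mp this
    exact ⟨m, by simpa using hm⟩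
  choose m hm using hm
  set i0 : Fin n := ⟨0, by omega⟩ with hi0
  set i1 : Fin n := ⟨1, by omega⟩ with hi1
  have key : ∀ t, t * (a i1 * b i0 - a i0 * b i1) = a i0 * m i1 t - a i1 * m i0 t := by
    intro t
    rw [hm, hm]
    ring
  have hD : a i1 * b i0 - a i0 * b i1 = 0 := by
    by_contra hD
    have hcount : (Set.range fun p : ℤ × ℤ => a i0 * p.1 - a i1 * p.2).Countable :=
      Set.countable_range _
    have huniv : (Set.univ : Set ℝ) ⊆
        Set.range fun p : ℤ × ℤ => a i0 * p.1 - a i1 * p.2 := by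
      intro u _
      refine ⟨(m i1 (u / (a i1 * b i0 - a i0 * b i1)), m i0 (u / (a i1 * b i0 - a i0 * b i1))), ?_⟩
      simp only
      rw [← key, div_mul_cancel₀ _ hD]
    exact Cardinal.not_countable_real (hcount.mono huniv)
  have hlin : ∀ t, s t = b i0 / a i0 * t := by
    intro t
    have h1 := key t
    rw [hD, mul_zero] at h1
    have h2 := int_relation_eq_zero hn ha (m i1 t) (m i0 t) (by linarith)
    have h3 := hm i0 t
    rw [h2.2, Int.cast_zero] at h3
    have ha0 : a i0 ≠ 0 := ha.ne_zero _
    field_simp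
    linarith
  have hne : b i0 / a i0 ≠ 0 := by
    intro h0
    have h1 := hs 1
    rw [hlin, h0, zero_mul, constantFlow_zero, one_mul] at h1
    have h2 : constantFlow a 1 = constantFlow a 0 := by
      rw [constantFlow_zero]
      exact mul_left_cancel (a := R) (by rw [h1, mul_one])
    exact one_ne_zero (hinj h2)
  refine ⟨Units.mk0 _ hne, fun t => ?_, fun β hβ => ?_⟩
  · rw [Units.val_mk0, ← hlin]
    exact hs t
  · refine Units.ext ?_
    have h1 := hβ 1
    simp only at h1
    rw [hs, mul_one] at h1
    have h2 := hinj (mul_right_cancel h1)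
    rw [Units.val_mk0, ← h2, hlin, mul_one]

/-- The multiplier representation `ρ_φ : S_φ → ℝ^*`, which takes `R` to the unique `α` such that
`R φ_t = φ_{α t} R` for all `t`. -/
def multiplierRep (hn : 2 ≤ n) {a : Fin n → ℝ} (ha : LinearIndependent ℚ a) :
    generalizedSymmetryGroup a →* ℝˣ :=
  MonoidHom.mk' (fun R => (existsUnique_multiplier hn ha R).choose) (by
    intro R Q
    refine ((existsUnique_multiplier hn ha (R * Q)).choose_spec.2 _ fun t => ?_).symm
    have hR := (existsUnique_multiplier hn ha R).choose_spec.1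
    have hQ := (existsUnique_multiplier hn ha Q).choose_spec.1
    simp only at hR hQ
    rw [Subgroup.coe_mul, mul_assoc, hQ, ← mul_assoc, hR, mul_assoc, Units.val_mul, mul_assoc])

theorem multiplierRep_spec (hn : 2 ≤ n) {a : Fin n → ℝ} (ha : LinearIndependent ℚ a)
    (R : generalizedSymmetryGroup a) (t : ℝ) :
    (R : TorusDiffeo n) * constantFlow a t =
      constantFlow a (multiplierRep hn ha R * t) * (R : TorusDiffeo n) :=
  (existsUnique_multiplier hn ha R).choose_spec.1 t

/-- `ρ_φ^{-1}(Λ)`, as a subgroup of `S_φ`. -/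
abbrev multiplierPreimage (hn : 2 ≤ n) {a : Fin n → ℝ} (ha : LinearIndependent ℚ a)
    (Λ : Subgroup ℝˣ) : Subgroup (generalizedSymmetryGroup a) :=
  Λ.comap (multiplierRep hn ha)

/-- `ker ρ_φ`, as a subgroup of `ρ_φ^{-1}(Λ)`. -/
abbrev symmetryKernel (hn : 2 ≤ n) {a : Fin n → ℝ} (ha : LinearIndependent ℚ a)
    (Λ : Subgroup ℝˣ) : Subgroup (multiplierPreimage hn ha Λ) :=
  (multiplierRep hn ha).ker.subgroupOf (multiplierPreimage hn ha Λ)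

end

noncomputable section

variable {n : ℕ}

/-! Rational independence makes the orbit of `0` under the flow dense (`denseRange_proj_smul`). The
relation `R φ_t = φ_{αt} R` reads `R (θ + π(ta)) = R θ + π(αta)`, so `θ ↦ R θ - R 0` is additive
along a dense set of increments, hence additive by continuity. A continuous endomorphism of the
torus comes from an integral matrix, so `R (π x) = π (A x) + R 0`, and comparison along the orbit
gives `A a = α a` (`linearPart_mulVec`).

The rest is algebra. The multiplier is an eigenvalue of `A`, hence a root of its monic
characteristic polynomial. By rational independence `α = 1` exactly when `A = 1`, so the kernel
consists of the translations. The symmetries fixing the origin form a complement: a translation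
corrects any `R` to fix `0` without changing its multiplier. This complement maps isomorphically
onto `Λ` and embeds in `GL(n, ℤ)` by linear parts. A normal complement would commute with every
translation, but only translations do so, which would force `Λ = 1`. -/

/-! ### Fourier coefficients and Kronecker's theorem -/

open UnitAddTorus MeasureTheory in
/-- Translating a function by `c` multiplies its Fourier coefficients by values of characters. -/
theorem UnitAddTorus.mFourierCoeff_comp_add_right {d : Type*} [Fintype d]
    (f : UnitAddTorus d → ℂ) (c : UnitAddTorus d) (k : d → ℤ) :
    mFourierCoeff (fun x => f (x + c)) k = mFourier k c * mFourierCoeff f k := by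
  have hadd : ∀ (l : d → ℤ) (x y : UnitAddTorus d),
      mFourier l (x + y) = mFourier l x * mFourier l y := fun l x y => by
    simp [mFourier, ← Finset.prod_mul_distrib, fourier_apply, AddCircle.toCircle_add]
  -- Rewrites the integrand as a function of `x + c` alone, so that translation invariance of Haar
  -- measure applies.
  have h : ∀ x, mFourier (-k) x • f (x + c) =
      mFourier k c * (mFourier (-k) (x + c) • f (x + c)) := fun x => by
    have h1 : mFourier k c * mFourier (-k) c = 1 := by
      rw [← mFourier_add, add_neg_cancel, mFourier_zero]; rfl
    rw [hadd, smul_eq_mul, smul_eq_mul]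
    linear_combination (-(mFourier (-k) x * f (x + c))) * h1
  have h2 : mFourierCoeff (fun x => f (x + c)) k =
      ∫ x, mFourier k c * (mFourier (-k) (x + c) • f (x + c))
        ∂(Measure.pi fun _ : d => AddCircle.haarAddCircle (T := 1)) := by
    simp_rw [← h]; rfl
  rw [h2, integral_const_mul, integral_add_right_eq_self
    (μ := Measure.pi fun _ : d => AddCircle.haarAddCircle (T := 1))
    (fun x => mFourier (-k) x • f x)]
  rfl

-- Finitely supported coefficients are summable, so the Fourier series converges pointwise to `f`
-- and only its constant term survives.
open UnitAddTorus in
theorem UnitAddTorus.eq_const_of_mFourierCoeff_eq_zero {d : Type*} [Fintype d]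
    (f : C(UnitAddTorus d, ℂ)) (hf : ∀ k ≠ 0, mFourierCoeff f k = 0) (x y : UnitAddTorus d) :
    f x = f y := by
  have hs : Summable (mFourierCoeff f) :=
    summable_of_ne_finset_zero (s := {0}) fun k hk => hf k (by simpa using hk)
  have h : ∀ z, f z = mFourierCoeff f 0 := fun z => by
    refine (hasSum_mFourier_series_apply_of_summable hs z).unique ?_
    convert hasSum_single (0 : d → ℤ) ?_ using 1
    · simp [mFourier_zero]
    · intro k hk
      simp [hf k hk]
  rw [h, h]

open UnitAddTorus in
/-- Kronecker's theorem: the orbit of `0` under `constantFlow a` is dense. -/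
theorem denseRange_proj_smul {a : Fin n → ℝ} (ha : LinearIndependent ℚ a) :
    DenseRange fun t : ℝ => Torus.proj (t • a) := by
  set φ : ℝ →+ Torus n := AddMonoidHom.mk' (fun t : ℝ => Torus.proj (t • a))
    fun s t => by rw [add_smul, Torus.proj_add] with hφ
  -- The distance to the closure `H` of the orbit is continuous and flow-invariant. Once Fourier
  -- analysis shows it constant, it is zero, because it vanishes at `0`.
  let H : AddSubgroup (Torus n) := φ.range.topologicalClosure
  have hmem : ∀ t, φ t ∈ H := fun t => subset_closure ⟨t, rfl⟩
  have hinv : ∀ t x, Metric.infDist (x + φ t) H = Metric.infDist x H := by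
    have hle : ∀ t x, Metric.infDist (x + φ t) H ≤ Metric.infDist x H := by
      intro t x
      refine (Metric.le_infDist ⟨0, H.zero_mem⟩).2 fun y hy => ?_
      refine (Metric.infDist_le_dist_of_mem (H.add_mem hy (hmem t))).trans ?_
      rw [dist_add_right]
    intro t x
    refine le_antisymm (hle t x) ?_
    simpa using hle (-t) (x + φ t)
  let f : C(UnitAddTorus (Fin n), ℂ) :=
    ⟨fun x => (Metric.infDist x (H : Set (Torus n)) : ℂ), by fun_prop⟩
  have hcoeff : ∀ k ≠ 0, mFourierCoeff f k = 0 := by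
    intro k hk
    set s : ℝ := ∑ i, k i * a i with hs
    have hs0 : s ≠ 0 := by
      intro h0
      apply hk
      have := Fintype.linearIndependent_iff.mp ha (fun i => (k i : ℚ)) (by
        simpa [Rat.smul_def] using h0)
      ext i
      exact_mod_cast this i
    -- At time `1 / (2s)` the character takes the value `exp(πi) = -1`, so invariance makes the
    -- coefficient equal to its own negative.
    have h1 := mFourierCoeff_comp_add_right f (φ (1 / (2 * s))) k
    have h2 : (fun x => f (x + φ (1 / (2 * s)))) = f := by
      ext x
      simp only [f, ContinuousMap.coe_mk, hinv]
    have h3 : mFourier k (φ (1 / (2 * s))) = -1 := by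
      have : mFourier k (φ (1 / (2 * s))) = ∏ i, Complex.exp (2 * Real.pi * Complex.I * k i *
          ((1 / (2 * s) * a i : ℝ) : ℂ)) := by
        change ∏ i, fourier (k i) (((1 / (2 * s) * a i : ℝ) : UnitAddCircle)) = _
        simp_rw [fourier_coe_apply, Complex.ofReal_one, div_one]
      rw [this, ← Complex.exp_sum, ← Complex.exp_pi_mul_I]
      congr 1
      have hsc : (s : ℂ) ≠ 0 := by exact_mod_cast hs0
      have hsum : (s : ℂ) = ∑ i, (k i : ℂ) * a i := by rw [hs]; push_cast; rfl
      have : ∀ i, 2 * Real.pi * Complex.I * k i * ((1 / (2 * s) * a i : ℝ) : ℂ) =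
          (Real.pi * Complex.I / s) * (k i * a i) := fun i => by
        push_cast
        field_simp
      simp_rw [this]
      rw [← Finset.mul_sum, ← hsum]
      field_simp
    rw [h2, h3] at h1
    linear_combination h1 / 2
  have huniv : ∀ x, x ∈ H := by
    intro x
    have h := eq_const_of_mFourierCoeff_eq_zero f hcoeff x 0
    have h0 : Metric.infDist x (H : Set (Torus n)) = 0 := by
      have : Metric.infDist (0 : Torus n) (H : Set (Torus n)) = 0 :=
        Metric.infDist_zero_of_mem H.zero_mem
      simp only [f, ContinuousMap.coe_mk, this] at h
      exact_mod_cast h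
    have hc : IsClosed (H : Set (Torus n)) := AddSubgroup.isClosed_topologicalClosure _
    exact (hc.mem_iff_infDist_zero ⟨0, H.zero_mem⟩).2 h0
  exact fun x => huniv x

/-! ### Continuous endomorphisms of the torus -/

theorem Torus.exists_int_of_proj_eq {x y : Fin n → ℝ} (h : Torus.proj x = Torus.proj y)
    (i : Fin n) : ∃ m : ℤ, x i - y i = m := by
  obtain ⟨m, hm⟩ := (proj_eq_zero_iff (x - y)).mp (by rw [Torus.proj_sub, h, sub_self])
  exact ⟨m i, hm i⟩

/-- If a coordinate differed, at time `1 / (2 (v i - w i))` the two lines would be half a unit apart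
in it, not an integer. This lifts identities on the torus to linear ones in `ℝ^n`. -/
theorem Torus.eq_of_proj_smul_eq {v w : Fin n → ℝ}
    (h : ∀ t : ℝ, Torus.proj (t • v) = Torus.proj (t • w)) : v = w := by
  ext i
  by_contra hne
  have hsub : v i - w i ≠ 0 := sub_ne_zero.mpr hne
  obtain ⟨m, hm⟩ := Torus.exists_int_of_proj_eq (h (1 / (2 * (v i - w i)))) i
  simp only [Pi.smul_apply, smul_eq_mul] at hm
  have h2 : (2 * m : ℝ) = 1 := by
    rw [← hm]
    field_simp
  have h3 : 2 * m = 1 := by exact_mod_cast h2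
  omega

/-- Every continuous endomorphism of the torus is induced by an integral matrix. -/
theorem Torus.exists_matrix_of_continuous (f : Torus n →+ Torus n) (hf : Continuous f) :
    ∃ A : Matrix (Fin n) (Fin n) ℤ, ∀ x,
      f (Torus.proj x) = Torus.proj ((A.map ((↑) : ℤ → ℝ)).mulVec x) := by
  have hb : ∀ i j : Fin n, ∃ b : ℝ, ∀ t : ℝ,
      f (Torus.proj (t • Pi.single j 1)) i = ((b * t : ℝ) : UnitAddCircle) := by
    intro i j
    refine exists_slope (c := fun t : ℝ => f (Torus.proj (t • Pi.single j 1)) i) ?_ ?_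
    · exact (continuous_apply i).comp (hf.comp (Torus.continuous_proj.comp (by fun_prop)))
    · intro s t
      rw [add_smul, Torus.proj_add, map_add]
      rfl
  choose b hb using hb
  -- Each coordinate line closes up at `t = 1`, which forces its slopes to be integers.
  have hint : ∀ i j, ∃ m : ℤ, (m : ℝ) = b i j := by
    intro i j
    have h0 : Torus.proj ((1 : ℝ) • (Pi.single j 1 : Fin n → ℝ)) = 0 :=
      (proj_eq_zero_iff _).mpr ⟨Pi.single j 1, fun i => by
        by_cases h : i = j
        · subst h; simp
        · simp [h]⟩
    have h1 := hb i j 1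
    rw [h0, map_zero, mul_one] at h1
    obtain ⟨m, hm⟩ := (AddCircle.coe_eq_zero_iff (1 : ℝ)).mp h1.symm
    exact ⟨m, by simpa using hm⟩
  choose A hA using hint
  let p : (Fin n → ℝ) →+ Torus n := AddMonoidHom.mk' Torus.proj Torus.proj_add
  refine ⟨Matrix.of A, fun x => ?_⟩
  have hx : x = ∑ j, x j • (Pi.single j 1 : Fin n → ℝ) := by
    ext i
    simp [Pi.single_apply]
  have h1 : f (Torus.proj x) = ∑ j, f (Torus.proj (x j • Pi.single j 1)) := by
    conv_lhs => rw [hx]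
    exact map_sum (f.comp p) _ _
  rw [h1]
  ext i
  rw [Finset.sum_apply]
  simp_rw [hb]
  have h2 : Torus.proj (((Matrix.of A).map ((↑) : ℤ → ℝ)).mulVec x) i =
      ((∑ j, b i j * x j : ℝ) : UnitAddCircle) := by
    simp [Torus.proj, Matrix.mulVec, dotProduct, hA]
  rw [h2]
  exact (map_sum (QuotientAddGroup.mk' (AddSubgroup.zmultiples (1 : ℝ))) _ _).symm

/-! ### Generalized symmetries are affine; linear parts and multipliers -/

theorem generalizedSymmetry_apply_add_proj_smul (hn : 2 ≤ n) {a : Fin n → ℝ}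
    (ha : LinearIndependent ℚ a) (R : generalizedSymmetryGroup a) (θ : Torus n) (t : ℝ) :
    (R : TorusDiffeo n) (θ + Torus.proj (t • a)) =
      (R : TorusDiffeo n) θ + Torus.proj ((multiplierRep hn ha R * t) • a) :=
  congrArg (fun f : TorusDiffeo n => f θ) (multiplierRep_spec hn ha R t)

/-- The linear part `θ ↦ R θ - R 0` of a generalized symmetry is an endomorphism. -/
theorem generalizedSymmetry_apply_add (hn : 2 ≤ n) {a : Fin n → ℝ}
    (ha : LinearIndependent ℚ a) (R : generalizedSymmetryGroup a) (θ η : Torus n) :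
    (R : TorusDiffeo n) (θ + η) - (R : TorusDiffeo n) 0 =
      ((R : TorusDiffeo n) θ - (R : TorusDiffeo n) 0) +
        ((R : TorusDiffeo n) η - (R : TorusDiffeo n) 0) := by
  have hc : Continuous (R : TorusDiffeo n) := (R : TorusDiffeo n).continuous
  -- With `θ` fixed, both sides are continuous in `η` and agree on the dense orbit.
  refine congrFun ((denseRange_proj_smul ha).equalizer
    (g := fun η => (R : TorusDiffeo n) (θ + η) - (R : TorusDiffeo n) 0)
    (h := fun η => ((R : TorusDiffeo n) θ - (R : TorusDiffeo n) 0) +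
        ((R : TorusDiffeo n) η - (R : TorusDiffeo n) 0))
    (by fun_prop) (by fun_prop) (funext fun t => ?_)) η
  have h0 := generalizedSymmetry_apply_add_proj_smul hn ha R 0 t
  rw [zero_add] at h0
  simp only [Function.comp_apply, h0, generalizedSymmetry_apply_add_proj_smul hn ha R θ t]
  abel

/-- Every generalized symmetry is affine. -/
theorem exists_linearPart (hn : 2 ≤ n) {a : Fin n → ℝ} (ha : LinearIndependent ℚ a)
    (R : generalizedSymmetryGroup a) :
    ∃ A : Matrix (Fin n) (Fin n) ℤ, ∀ x, (R : TorusDiffeo n) (Torus.proj x) =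
      Torus.proj ((A.map ((↑) : ℤ → ℝ)).mulVec x) + (R : TorusDiffeo n) 0 := by
  have hc : Continuous (R : TorusDiffeo n) := (R : TorusDiffeo n).continuous
  obtain ⟨A, hA⟩ := Torus.exists_matrix_of_continuous
    (AddMonoidHom.mk' (fun θ => (R : TorusDiffeo n) θ - (R : TorusDiffeo n) 0)
      (generalizedSymmetry_apply_add hn ha R)) (hc.sub continuous_const)
  exact ⟨A, fun x => sub_eq_iff_eq_add.mp (hA x)⟩

theorem Matrix.eq_of_proj_mulVec_eq {A B : Matrix (Fin n) (Fin n) ℤ}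
    (h : ∀ x, Torus.proj ((A.map ((↑) : ℤ → ℝ)).mulVec x) =
      Torus.proj ((B.map ((↑) : ℤ → ℝ)).mulVec x)) : A = B := by
  have h1 : ∀ v, (A.map ((↑) : ℤ → ℝ)).mulVec v = (B.map ((↑) : ℤ → ℝ)).mulVec v := fun v =>
    Torus.eq_of_proj_smul_eq fun t => by
      rw [← Matrix.mulVec_smul, ← Matrix.mulVec_smul, h]
  exact Matrix.map_injective Int.cast_injective (Matrix.mulVec_injective (funext h1))

/-- The integral matrix of the linear part of a generalized symmetry. -/
def linearPart (hn : 2 ≤ n) {a : Fin n → ℝ} (ha : LinearIndependent ℚ a)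
    (R : generalizedSymmetryGroup a) : Matrix (Fin n) (Fin n) ℤ :=
  (exists_linearPart hn ha R).choose

theorem apply_proj (hn : 2 ≤ n) {a : Fin n → ℝ} (ha : LinearIndependent ℚ a)
    (R : generalizedSymmetryGroup a) (x : Fin n → ℝ) : (R : TorusDiffeo n) (Torus.proj x) =
      Torus.proj (((linearPart hn ha R).map ((↑) : ℤ → ℝ)).mulVec x) + (R : TorusDiffeo n) 0 :=
  (exists_linearPart hn ha R).choose_spec x

/-- Uniqueness of the matrix makes the choice in `linearPart` harmless; the homomorphism laws of
`linearRep` rest on it. -/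
theorem linearPart_eq (hn : 2 ≤ n) {a : Fin n → ℝ} (ha : LinearIndependent ℚ a)
    {R : generalizedSymmetryGroup a} {A : Matrix (Fin n) (Fin n) ℤ}
    (h : ∀ x, (R : TorusDiffeo n) (Torus.proj x) =
      Torus.proj ((A.map ((↑) : ℤ → ℝ)).mulVec x) + (R : TorusDiffeo n) 0) :
    linearPart hn ha R = A :=
  Matrix.eq_of_proj_mulVec_eq fun x => add_right_cancel ((apply_proj hn ha R x).symm.trans (h x))

/-- The representation of the generalized symmetry group by linear parts in `GL(n, ℤ)`. -/
def linearRep (hn : 2 ≤ n) {a : Fin n → ℝ} (ha : LinearIndependent ℚ a) :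
    generalizedSymmetryGroup a →* Matrix.GeneralLinearGroup (Fin n) ℤ :=
  -- The source is a group, so a monoid homomorphism into matrices automatically lands in the units.
  MonoidHom.toHomUnits
    { toFun := linearPart hn ha
      map_one' := linearPart_eq hn ha fun x => by
        have h0 : ((1 : generalizedSymmetryGroup a) : TorusDiffeo n) 0 = 0 := rfl
        rw [h0, add_zero, Matrix.map_one _ Int.cast_zero Int.cast_one, Matrix.one_mulVec]
        rfl
      map_mul' := fun R Q => linearPart_eq hn ha fun x => by
        have hmap : (linearPart hn ha R * linearPart hn ha Q).map ((↑) : ℤ → ℝ) =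
            (linearPart hn ha R).map (↑) * (linearPart hn ha Q).map (↑) :=
          Matrix.map_mul (f := Int.castRingHom ℝ)
        -- `apply_proj` needs a point of the form `π x`, hence the representative of `Q 0`.
        rw [Subgroup.coe_mul, TorusDiffeo.mul_apply, TorusDiffeo.mul_apply, apply_proj hn ha Q,
          ← Torus.proj_rep ((Q : TorusDiffeo n) 0), ← Torus.proj_add, apply_proj hn ha R,
          apply_proj hn ha R (Torus.rep _), Matrix.mulVec_add, Torus.proj_add, hmap,
          Matrix.mulVec_mulVec, add_assoc] }

theorem coe_linearRep (hn : 2 ≤ n) {a : Fin n → ℝ} (ha : LinearIndependent ℚ a)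
    (R : generalizedSymmetryGroup a) :
    (linearRep hn ha R : Matrix (Fin n) (Fin n) ℤ) = linearPart hn ha R := rfl

/-- On the orbit of `0`, the affine formula and the multiplier relation give two expressions for
`R`; cancelling `R 0` leaves two projected lines to compare. -/
theorem linearPart_mulVec (hn : 2 ≤ n) {a : Fin n → ℝ} (ha : LinearIndependent ℚ a)
    (R : generalizedSymmetryGroup a) :
    ((linearPart hn ha R).map ((↑) : ℤ → ℝ)).mulVec a = (multiplierRep hn ha R : ℝ) • a := by
  refine Torus.eq_of_proj_smul_eq fun t => ?_
  have h := generalizedSymmetry_apply_add_proj_smul hn ha R 0 t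
  rw [zero_add, apply_proj hn ha R, add_comm] at h
  rw [← Matrix.mulVec_smul, add_left_cancel h, smul_smul, mul_comm]

/-- Both directions come from `A a = α a`. If `A = 1`, a nonzero coordinate of `a` gives `α = 1`; if
`α = 1`, each row of `A - 1` is a rational relation among the `a j`, hence zero. -/
theorem linearRep_eq_one_iff (hn : 2 ≤ n) {a : Fin n → ℝ} (ha : LinearIndependent ℚ a)
    (R : generalizedSymmetryGroup a) : linearRep hn ha R = 1 ↔ multiplierRep hn ha R = 1 := by
  have h := linearPart_mulVec hn ha R
  rw [← Units.val_inj, coe_linearRep, Units.val_one]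
  constructor
  · intro h1
    rw [h1, Matrix.map_one _ Int.cast_zero Int.cast_one, Matrix.one_mulVec] at h
    have h2 := congrFun h ⟨0, by omega⟩
    simp only [Pi.smul_apply, smul_eq_mul] at h2
    exact Units.ext (by
      rw [Units.val_one]
      exact mul_right_cancel₀ (ha.ne_zero ⟨0, by omega⟩) (h2.symm.trans (one_mul _).symm))
  · intro h1
    rw [h1, Units.val_one, one_smul] at h
    ext i j
    have h2 := congrFun h i
    have h3 := Fintype.linearIndependent_iff.mp ha
      (fun j => ((linearPart hn ha R - 1) i j : ℚ)) (by
        have : ∀ j, ((linearPart hn ha R - 1) i j : ℚ) • a j =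
            (linearPart hn ha R i j : ℝ) * a j - if i = j then a j else 0 := fun j => by
          rw [Rat.smul_def, Matrix.sub_apply, Matrix.one_apply]
          split_ifs <;> push_cast <;> ring
        simp_rw [this]
        rw [Finset.sum_sub_distrib, Finset.sum_ite_eq]
        simpa [Matrix.mulVec, dotProduct, sub_eq_zero] using h2) j
    have h4 : (linearPart hn ha R - 1) i j = 0 := by exact_mod_cast h3
    exact sub_eq_zero.mp h4

theorem multiplierRep_eq_one_iff (hn : 2 ≤ n) {a : Fin n → ℝ} (ha : LinearIndependent ℚ a)
    (R : generalizedSymmetryGroup a) :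
    multiplierRep hn ha R = 1 ↔
      (R : TorusDiffeo n) = TorusDiffeo.translation ((R : TorusDiffeo n) 0) := by
  rw [← linearRep_eq_one_iff, ← Units.val_inj, coe_linearRep, Units.val_one]
  constructor
  · intro h
    refine Diffeomorph.ext fun θ => ?_
    rw [← Torus.proj_rep θ, apply_proj hn ha, h, Matrix.map_one _ Int.cast_zero Int.cast_one,
      Matrix.one_mulVec]
    rfl
  · intro h
    refine linearPart_eq hn ha fun x => ?_
    rw [Matrix.map_one _ Int.cast_zero Int.cast_one, Matrix.one_mulVec]
    exact congrArg (fun f : TorusDiffeo n => f (Torus.proj x)) h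

/-- Multipliers are eigenvalues of integral matrices, hence algebraic integers. -/
theorem exists_monic_aeval_multiplierRep (hn : 2 ≤ n) {a : Fin n → ℝ}
    (ha : LinearIndependent ℚ a) (R : generalizedSymmetryGroup a) :
    ∃ p : Polynomial ℤ, p.Monic ∧ p.natDegree ≤ n ∧
      Polynomial.aeval (multiplierRep hn ha R : ℝ) p = 0 := by
  refine ⟨(linearPart hn ha R).charpoly, Matrix.charpoly_monic _, by simp, ?_⟩
  rw [Polynomial.aeval_def, ← Polynomial.eval_map, algebraMap_int_eq, ← Matrix.charpoly_map,
    Matrix.eval_charpoly]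
  -- The determinant of `α - A` vanishes because the nonzero vector `a` lies in its kernel.
  refine Matrix.exists_mulVec_eq_zero_iff.mp
    ⟨a, fun h => ha.ne_zero ⟨0, by omega⟩ (congrFun h _), ?_⟩
  rw [Matrix.sub_mulVec, sub_eq_zero]
  refine Eq.trans ?_ (linearPart_mulVec hn ha R).symm
  ext i
  simp [Matrix.mulVec_diagonal]

/-! ### Translations as the kernel of the multiplier representation -/

theorem translation_mul (c d : Torus n) : TorusDiffeo.translation (c + d) =
    TorusDiffeo.translation c * TorusDiffeo.translation d :=
  Diffeomorph.ext fun θ => by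
    simp only [TorusDiffeo.mul_apply, TorusDiffeo.translation_apply]
    abel

/-- The translations, as a homomorphism into the generalized symmetry group. -/
def translationHom (a : Fin n → ℝ) : Multiplicative (Torus n) →* generalizedSymmetryGroup a :=
  MonoidHom.mk' (fun c => ⟨TorusDiffeo.translation c.toAdd,
    Subgroup.centralizer_le_normalizer (flowSubgroup a : Set (TorusDiffeo n)) (Subgroup.mem_centralizer_iff.mpr (by
      rintro _ ⟨t, rfl⟩
      rw [constantFlow, ← translation_mul, ← translation_mul, add_comm]))⟩)
    fun c d => Subtype.ext (translation_mul _ _)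

theorem translationHom_apply (a : Fin n → ℝ) (c : Multiplicative (Torus n)) (θ : Torus n) :
    (translationHom a c : TorusDiffeo n) θ = θ + c.toAdd := rfl

theorem translationHom_injective (a : Fin n → ℝ) : Function.Injective (translationHom a) := by
  intro c d h
  have h0 := congrArg (fun R : generalizedSymmetryGroup a => (R : TorusDiffeo n) 0) h
  simpa only [translationHom_apply, zero_add, EmbeddingLike.apply_eq_iff_eq] using h0

theorem range_translationHom (hn : 2 ≤ n) {a : Fin n → ℝ} (ha : LinearIndependent ℚ a) :
    (translationHom a).range = (multiplierRep hn ha).ker := by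
  ext R
  rw [MonoidHom.mem_ker, multiplierRep_eq_one_iff]
  constructor
  · rintro ⟨c, rfl⟩
    rw [translationHom_apply, zero_add]
    rfl
  · exact fun h => ⟨Multiplicative.ofAdd ((R : TorusDiffeo n) 0), Subtype.ext h.symm⟩

theorem multiplierRep_translationHom (hn : 2 ≤ n) {a : Fin n → ℝ} (ha : LinearIndependent ℚ a)
    (c : Multiplicative (Torus n)) : multiplierRep hn ha (translationHom a c) = 1 :=
  (range_translationHom hn ha).le ⟨c, rfl⟩

theorem nonempty_symmetryKernel_mulEquiv (hn : 2 ≤ n) {a : Fin n → ℝ}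
    (ha : LinearIndependent ℚ a) (Λ : Subgroup ℝˣ) :
    Nonempty (symmetryKernel hn ha Λ ≃* Multiplicative (Torus n)) := by
  have hle : (multiplierRep hn ha).ker ≤ multiplierPreimage hn ha Λ := fun R hR => by
    rw [Subgroup.mem_comap, MonoidHom.mem_ker.mp hR]
    exact Λ.one_mem
  exact ⟨(Subgroup.subgroupOfEquivOfLe hle).trans
    ((MulEquiv.subgroupCongr (range_translationHom hn ha).symm).trans
      (MonoidHom.ofInjective (translationHom_injective a)).symm)⟩

/-! ### The stabilizer of the origin as a complement -/

/-- The generalized symmetries that fix the origin. -/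
def originStabilizer (a : Fin n → ℝ) : Subgroup (generalizedSymmetryGroup a) where
  carrier := {R | (R : TorusDiffeo n) 0 = 0}
  one_mem' := rfl
  mul_mem' {R Q} hR hQ := by
    change (R : TorusDiffeo n) ((Q : TorusDiffeo n) 0) = 0
    rw [show (Q : TorusDiffeo n) 0 = 0 from hQ, show (R : TorusDiffeo n) 0 = 0 from hR]
  inv_mem' {R} hR := by
    change (R : TorusDiffeo n).symm 0 = 0
    rw [← show (R : TorusDiffeo n) 0 = 0 from hR, Diffeomorph.symm_apply_apply]
    exact hR.symm

theorem translationHom_mul_mem_originStabilizer {a : Fin n → ℝ} (R : generalizedSymmetryGroup a) :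
    translationHom a (Multiplicative.ofAdd (-(R : TorusDiffeo n) 0)) * R ∈ originStabilizer a := by
  change (R : TorusDiffeo n) 0 + -(R : TorusDiffeo n) 0 = 0
  exact add_neg_cancel _

theorem eq_one_of_mem_originStabilizer (hn : 2 ≤ n) {a : Fin n → ℝ} (ha : LinearIndependent ℚ a)
    {R : generalizedSymmetryGroup a} (hR : R ∈ originStabilizer a)
    (h : multiplierRep hn ha R = 1) : R = 1 := by
  have h0 : (R : TorusDiffeo n) 0 = 0 := hR
  rw [multiplierRep_eq_one_iff, h0] at h
  refine Subtype.ext (h.trans (Diffeomorph.ext fun θ => ?_))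
  rw [TorusDiffeo.translation_apply, add_zero]
  rfl

theorem isComplement'_originStabilizer (hn : 2 ≤ n) {a : Fin n → ℝ} (ha : LinearIndependent ℚ a)
    (Λ : Subgroup ℝˣ) : (symmetryKernel hn ha Λ).IsComplement'
      ((originStabilizer a).subgroupOf (multiplierPreimage hn ha Λ)) := by
  refine Subgroup.isComplement'_of_disjoint_and_mul_eq_univ ?_ ?_
  · rw [Subgroup.disjoint_def]
    intro R h1 h2
    exact Subtype.ext (eq_one_of_mem_originStabilizer hn ha h2 h1)
  · refine Set.eq_univ_of_forall fun R => ?_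
    obtain ⟨R, hR⟩ := R
    let T := translationHom a (Multiplicative.ofAdd (-(R : TorusDiffeo n) 0))
    have hT1 : multiplierRep hn ha T = 1 := multiplierRep_translationHom hn ha _
    have hTΛ : T ∈ multiplierPreimage hn ha Λ := by
      rw [Subgroup.mem_comap, hT1]
      exact Λ.one_mem
    let T' : multiplierPreimage hn ha Λ := ⟨T, hTΛ⟩
    let R' : multiplierPreimage hn ha Λ := ⟨R, hR⟩
    have hTK : T' ∈ symmetryKernel hn ha Λ := hT1
    have hTR : T' * R' ∈ (originStabilizer a).subgroupOf (multiplierPreimage hn ha Λ) :=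
      translationHom_mul_mem_originStabilizer R
    exact Set.mem_mul.mpr ⟨T'⁻¹, inv_mem hTK, T' * R', hTR, inv_mul_cancel_left T' R'⟩

/-- The isomorphism is the multiplier itself: injective because a translation fixing `0` is trivial,
surjective because any `R` can be translated into the stabilizer with the same multiplier. -/
theorem nonempty_originStabilizer_mulEquiv (hn : 2 ≤ n) {a : Fin n → ℝ}
    (ha : LinearIndependent ℚ a) {Λ : Subgroup ℝˣ} (hΛ : Λ ≤ (multiplierRep hn ha).range) :
    Nonempty ((originStabilizer a).subgroupOf (multiplierPreimage hn ha Λ) ≃* Λ) := by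
  let f : (originStabilizer a).subgroupOf (multiplierPreimage hn ha Λ) →* Λ :=
    ((multiplierRep hn ha).subgroupComap Λ).comp (Subgroup.subtype _)
  refine ⟨MulEquiv.ofBijective f ⟨?_, ?_⟩⟩
  · rw [injective_iff_map_eq_one]
    intro R hR
    exact Subtype.ext (Subtype.ext (eq_one_of_mem_originStabilizer hn ha R.2
      (congrArg Subtype.val hR)))
  · rintro ⟨α, hα⟩
    obtain ⟨R, rfl⟩ := hΛ hα
    have h1 : multiplierRep hn ha
        (translationHom a (Multiplicative.ofAdd (-(R : TorusDiffeo n) 0)) * R) =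
          multiplierRep hn ha R := by
      rw [map_mul, multiplierRep_translationHom, one_mul]
    exact ⟨⟨⟨translationHom a (Multiplicative.ofAdd (-(R : TorusDiffeo n) 0)) * R, by rwa [Subgroup.mem_comap, h1]⟩, translationHom_mul_mem_originStabilizer R⟩,
      Subtype.ext h1⟩

/-! ### Non-normality of complements and the embedding in `GL(n, ℤ)` -/

/-- A generalized symmetry that commutes with all translations has multiplier one. -/
theorem multiplierRep_eq_one_of_commute (hn : 2 ≤ n) {a : Fin n → ℝ}
    (ha : LinearIndependent ℚ a) {R : generalizedSymmetryGroup a}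
    (h : ∀ c, Commute (translationHom a c) R) : multiplierRep hn ha R = 1 := by
  rw [multiplierRep_eq_one_iff]
  refine Diffeomorph.ext fun θ => ?_
  -- Commutation with translation by `θ`, evaluated at `0`, gives `R 0 + θ = R θ`.
  have h1 := congrArg (fun Q : generalizedSymmetryGroup a => (Q : TorusDiffeo n) 0)
    (h (Multiplicative.ofAdd θ)).eq
  simp only [Subgroup.coe_mul, TorusDiffeo.mul_apply, translationHom_apply, toAdd_ofAdd,
    zero_add] at h1
  rw [← h1, TorusDiffeo.translation_apply, add_comm]

/-- Disjoint normal subgroups commute elementwise, so a normal `K` would centralize the translations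
and have only multiplier one. Yet `K` realizes every multiplier in `Λ`. -/
theorem not_normal_of_isComplement' (hn : 2 ≤ n) {a : Fin n → ℝ} (ha : LinearIndependent ℚ a)
    {Λ : Subgroup ℝˣ} (hΛ : Λ ≤ (multiplierRep hn ha).range) (hne : Λ ≠ ⊥)
    {K : Subgroup (multiplierPreimage hn ha Λ)}
    (hK : (symmetryKernel hn ha Λ).IsComplement' K) : ¬ K.Normal := by
  intro hnormal
  apply hne
  rw [eq_bot_iff]
  intro α hα
  obtain ⟨R, rfl⟩ := hΛ hα
  obtain ⟨⟨N, Q⟩, hNQ⟩ := hK.2 ⟨R, hα⟩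
  have hmul : multiplierRep hn ha R = multiplierRep hn ha Q := by
    have h1 : (N : generalizedSymmetryGroup a) * Q = R := congrArg Subtype.val hNQ
    rw [← h1, map_mul, show multiplierRep hn ha N = 1 from N.2, one_mul]
  rw [Subgroup.mem_bot, hmul]
  refine multiplierRep_eq_one_of_commute hn ha fun c => ?_
  have hc : multiplierRep hn ha (translationHom a c) = 1 := multiplierRep_translationHom hn ha c
  have hcΛ : translationHom a c ∈ multiplierPreimage hn ha Λ := by
    rw [Subgroup.mem_comap, hc]
    exact Λ.one_mem
  exact congrArg Subtype.val (Subgroup.commute_of_normal_of_disjoint _ _ inferInstance hnormal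
    hK.disjoint ⟨_, hcΛ⟩ Q hc Q.2)

/-- `linearRep` and `multiplierRep` have the same kernel, so linear parts are faithful on the origin
stabilizer; commutativity is carried over from `Λ`. -/
theorem exists_mulEquiv_subgroup_generalLinearGroup (hn : 2 ≤ n) {a : Fin n → ℝ}
    (ha : LinearIndependent ℚ a) {Λ : Subgroup ℝˣ} (hΛ : Λ ≤ (multiplierRep hn ha).range) :
    ∃ P : Subgroup (Matrix.GeneralLinearGroup (Fin n) ℤ),
      IsMulCommutative P ∧ Nonempty (Λ ≃* P) := by
  obtain ⟨e⟩ := nonempty_originStabilizer_mulEquiv hn ha hΛ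
  let f : (originStabilizer a).subgroupOf (multiplierPreimage hn ha Λ) →*
      Matrix.GeneralLinearGroup (Fin n) ℤ :=
    ((linearRep hn ha).comp (Subgroup.subtype _)).comp (Subgroup.subtype _)
  have hf : Function.Injective f := by
    rw [injective_iff_map_eq_one]
    intro R hR
    exact Subtype.ext (Subtype.ext (eq_one_of_mem_originStabilizer hn ha R.2
      ((linearRep_eq_one_iff hn ha _).mp hR)))
  let g : Λ ≃* f.range := e.symm.trans (MonoidHom.ofInjective hf)
  refine ⟨f.range, ⟨⟨fun x y => g.symm.injective ?_⟩⟩, ⟨g⟩⟩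
  rw [map_mul, map_mul, mul_comm]

theorem mainTheorem1 (n : ℕ) (hn : 2 ≤ n) (a : Fin n → ℝ) (ha : LinearIndependent ℚ a)
    (Λ : Subgroup ℝˣ) (hΛ : Λ ≤ (multiplierRep hn ha).range) (hne : Λ ≠ ⊥) :
    -- the kernel of the multiplier representation is normal and isomorphic to the torus
    (symmetryKernel hn ha Λ).Normal ∧
    Nonempty (symmetryKernel hn ha Λ ≃* Multiplicative (Torus n)) ∧
    -- it has a complement isomorphic to `Λ` (internal semidirect product)
    (∃ K : Subgroup (multiplierPreimage hn ha Λ),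
      (symmetryKernel hn ha Λ).IsComplement' K ∧ Nonempty (K ≃* Λ)) ∧
    -- no complement is normal (the product is not direct)
    (∀ K : Subgroup (multiplierPreimage hn ha Λ),
      (symmetryKernel hn ha Λ).IsComplement' K → ¬ K.Normal) ∧
    -- the elements of `Λ` are algebraic integers of degree at most `n`
    (∀ α ∈ Λ, ∃ p : Polynomial ℤ,
      p.Monic ∧ p.natDegree ≤ n ∧ Polynomial.aeval (α : ℝ) p = 0) ∧
    -- `Λ` is isomorphic to an abelian subgroup of `GL(n, ℤ)`
    (∃ P : Subgroup (Matrix.GeneralLinearGroup (Fin n) ℤ),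
      IsMulCommutative P ∧ Nonempty (Λ ≃* P)) := by
  refine ⟨inferInstance, nonempty_symmetryKernel_mulEquiv hn ha Λ,
    ⟨_, isComplement'_originStabilizer hn ha Λ, nonempty_originStabilizer_mulEquiv hn ha hΛ⟩,
    fun K hK => not_normal_of_isComplement' hn ha hΛ hne hK, fun α hα => ?_,
    exists_mulEquiv_subgroup_generalLinearGroup hn ha hΛ⟩
  obtain ⟨R, rfl⟩ := hΛ hα
  exact exists_monic_aeval_multiplierRep hn ha R

end
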